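/- Algebras are nonempty. An equation in a language without constants and without relation symbols other than equality is called *equilinear* if, up to exchanging its two sides, it has the form $f(x_1,\dots,x_n)=y$, or the form $f(x_1,\dots,x_n)=g(y_1,\dots,y_m)$ with $\{x_1,\dots,x_n\}=\{y_1,\dots,y_m\}$; here $f,g$ are operation symbols, not necessarily distinct, and the $x_i,y_j,y$ are variables, not necessarily distinct. A *Fraïssé limit* of a class $\mathcal K$ of structures is a countable (possibly finite) structure $M$ such that every embedding of a finitely generated substructure of $M$ into $M$ extends to an automorphism of $M$, and such that the finitely generated structures that embed into $M$ are exactly the members of $\mathcal K$. **Corollary 3.4.** Let $\mathcal V$ be a variety in a finite language without constants, axiomatized by a (possibly infinite) set of equilinear equations. Then the class of finite algebras in $\mathcal V$ has a Fraïssé limit. In particular, the class of finite algebras has a Fraïssé limit for each of the following varieties, given by their operations and axioms. 1. The variety with a Maltsev operation: $f$ ternary, $x=f(x,y,y)$, $f(x,x,y)=y$. 2. The variety with a Pixley operation: $p$ ternary, $p(x,y,y)=x$, $p(x,x,y)=y$, $p(x,y,x)=x$. 3. For every $n\ge 1$, the variety with an $n$-ary near unanimity operation: $f(x,\dots,x,y,x,\dots,x)=x$,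 with $y$ in any one of the $n$ places. 4. For every $n\ge 0$, the variety with $n$ Day operations: $m_0,\dots,m_{n-1}$ of arity $4$, with $m_0(x,y,z,t)=x$ and $m_{n-1}(x,y,z,t)=t$ (both only if $n\ge1$), $m_i(x,y,y,x)=x$ for $i\le n-1$, and, for $i+1\le n-1$, $m_i(x,x,t,t)=m_{i+1}(x,x,t,t)$ if $i$ is even, $m_i(x,y,y,t)=m_{i+1}(x,y,y,t)$ if $i$ is odd. 5. For every $n\ge 0$, the variety with $n$ Jónsson operations: $t_0,\dots,t_{n-1}$ ternary, with $t_0(x,y,z)=x$ and $t_{n-1}(x,y,z)=z$ (both only if $n\ge1$), $t_i(x,y,x)=x$ for $i\le n-1$, and, for $i+1\le n-1$, $t_i(x,x,z)=t_{i+1}(x,x,z)$ if $i$ is even, $t_i(x,z,z)=t_{i+1}(x,z,z)$ if $i$ is odd. 6. For every $n\ge 0$, the variety with $n$ Hagemann–Mitschke operations: $p_0,\dots,p_{n-1}$ ternary, with $p_0(x,z,z)=x$ and $p_{n-1}(x,x,z)=z$ (both only if $n\ge1$), and $p_i(x,x,z)=p_{i+1}(x,z,z)$ for $i+1\le n-1$.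 -/

import Mathlib

open FirstOrder CategoryTheory

universe u v w

namespace FirstOrder.Language

/-- An equation in the language `L`: a formal identity between two terms in the variables
indexed by `ℕ`. -/
structure Equation (L : Language.{u, v}) where
  lhs : L.Term ℕ
  rhs : L.Term ℕ

namespace Equation

variable {L : Language.{u, v}}

/-- The equation `e` is valid in the algebra `A`: both sides agree under every assignment. -/
def ValidIn (e : L.Equation) (A : Type w) [L.Structure A] : Prop :=
  ∀ ρ : ℕ → A, e.lhs.realize ρ = e.rhs.realize ρ

/-- Equilinear equations in a language without constants: the equations
`f(x₁, …, xₙ) = y` (with the sides in either order), and the equations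
`f(x₁, …, xₙ) = g(y₁, …, yₘ)` with `{x₁, …, xₙ} = {y₁, …, yₘ}`. The variables need not be
distinct, and neither need `f` and `g`. -/
inductive IsEquilinear : L.Equation → Prop
  | op_var {n : ℕ} (f : L.Functions n) (x : Fin n → ℕ) (y : ℕ) :
      IsEquilinear ⟨Term.func f fun i => Term.var (x i), Term.var y⟩
  | var_op {n : ℕ} (f : L.Functions n) (x : Fin n → ℕ) (y : ℕ) :
      IsEquilinear ⟨Term.var y, Term.func f fun i => Term.var (x i)⟩
  | op_op {n m : ℕ} (f : L.Functions n) (g : L.Functions m) (x : Fin n → ℕ) (y : Fin m → ℕ)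
      (h : Set.range x = Set.range y) :
      IsEquilinear ⟨Term.func f fun i => Term.var (x i), Term.func g fun j => Term.var (y j)⟩

end Equation

/-- The variety axiomatized by a set `E` of equations. Algebras are nonempty. -/
def variety {L : Language.{u, v}} (E : Set L.Equation) : Set (Bundled.{w} L.Structure) :=
  {A | Nonempty A ∧ ∀ e ∈ E, e.ValidIn A}

/-- The finite algebras of the variety axiomatized by `E`. -/
def finiteAlgebras {L : Language.{u, v}} (E : Set L.Equation) : Set (Bundled.{w} L.Structure) :=
  {A | A ∈ variety E ∧ Finite A}

/-- A class `K` of nonempty structures has a Fraïssé limit: a nonempty countable ultrahomogeneous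
structure such that the nonempty finitely generated structures that embed into it are exactly the
members of `K`. Mathlib's age of a structure includes the empty structure if there are no
constants, hence the empty structures are adjoined to `K` (there are none if there are constants).
Embeddings of the empty substructure put no condition on ultrahomogeneity. -/
def HasFraisseLimit {L : Language.{u, v}} [Countable (Σ n, L.Functions n)]
    (K : Set (Bundled.{w} L.Structure)) : Prop :=
  ∃ (M : Type w) (_ : L.Structure M) (_ : Countable M),
    Nonempty M ∧ L.IsFraisseLimit (K ∪ {A : Bundled.{w} L.Structure | IsEmpty A}) M

/-! ### The varieties that define some classical Maltsev conditions -/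

/-- The symbols of a language with one operation of arity `k` for each `i : ι`. -/
inductive OpSymbol (ι : Type) (k : ℕ) : ℕ → Type
  | op (i : ι) : OpSymbol ι k k

/-- The language with one operation symbol of arity `k` for each `i : ι`, and nothing else. -/
def opLanguage (ι : Type) (k : ℕ) : Language.{0, 0} :=
  ⟨OpSymbol ι k, fun _ => Empty⟩

instance countable_opLanguage (ι : Type) [Countable ι] (k : ℕ) :
    Countable (Σ n, (opLanguage ι k).Functions n) := by
  have hs : Function.Surjective
      (fun i : ι => (⟨k, OpSymbol.op i⟩ : Σ n, (opLanguage ι k).Functions n)) := by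
    rintro ⟨_, ⟨i⟩⟩
    exact ⟨i, rfl⟩
  exact hs.countable

/-- The term `fᵢ(x₁, …, xₖ)`, where `fᵢ` is the operation symbol with index `i`. -/
def opTerm {ι : Type} {k : ℕ} (i : ι) (x : Fin k → ℕ) : (opLanguage ι k).Term ℕ :=
  Term.func (OpSymbol.op i : (opLanguage ι k).Functions k) fun j => Term.var (x j)

/-- `x = f(x, y, y)` and `f(x, x, y) = y`. -/
def maltsevEquations : Set (opLanguage Unit 3).Equation :=
  {⟨Term.var 0, opTerm () ![0, 1, 1]⟩, ⟨opTerm () ![0, 0, 1], Term.var 1⟩}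

/-- `p(x, y, y) = x`, `p(x, x, y) = y` and `p(x, y, x) = x`. -/
def pixleyEquations : Set (opLanguage Unit 3).Equation :=
  {⟨opTerm () ![0, 1, 1], Term.var 0⟩, ⟨opTerm () ![0, 0, 1], Term.var 1⟩,
    ⟨opTerm () ![0, 1, 0], Term.var 0⟩}

/-- `f(x, …, x, y, x, …, x) = x`, with `y` in any of the `n` places. -/
def nearUnanimityEquations (n : ℕ) : Set (opLanguage Unit n).Equation :=
  {e | ∃ j : Fin n, e = ⟨opTerm () (Function.update (fun _ => 0) j 1), Term.var 0⟩}

/-- The equations of `n` Day operations `m₀, …, mₙ₋₁`: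
`m₀(x, y, z, t) = x`, `mₙ₋₁(x, y, z, t) = t`, `mᵢ(x, y, y, x) = x`,
`mᵢ(x, x, t, t) = mᵢ₊₁(x, x, t, t)` for `i` even, `mᵢ(x, y, y, t) = mᵢ₊₁(x, y, y, t)` for `i` odd.
-/
def dayEquations (n : ℕ) : Set (opLanguage (Fin n) 4).Equation :=
  {e | (∃ i : Fin n, i.val = 0 ∧ e = ⟨opTerm i ![0, 1, 2, 3], Term.var 0⟩) ∨
    (∃ i : Fin n, i.val + 1 = n ∧ e = ⟨opTerm i ![0, 1, 2, 3], Term.var 3⟩) ∨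
    (∃ i : Fin n, e = ⟨opTerm i ![0, 1, 1, 0], Term.var 0⟩) ∨
    (∃ i j : Fin n, j.val = i.val + 1 ∧ Even i.val ∧
      e = ⟨opTerm i ![0, 0, 3, 3], opTerm j ![0, 0, 3, 3]⟩) ∨
    (∃ i j : Fin n, j.val = i.val + 1 ∧ Odd i.val ∧
      e = ⟨opTerm i ![0, 1, 1, 3], opTerm j ![0, 1, 1, 3]⟩)}

/-- The equations of `n` Jónsson operations `t₀, …, tₙ₋₁`:
`t₀(x, y, z) = x`, `tₙ₋₁(x, y, z) = z`, `tᵢ(x, y, x) = x`,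
`tᵢ(x, x, z) = tᵢ₊₁(x, x, z)` for `i` even, `tᵢ(x, z, z) = tᵢ₊₁(x, z, z)` for `i` odd. -/
def jonssonEquations (n : ℕ) : Set (opLanguage (Fin n) 3).Equation :=
  {e | (∃ i : Fin n, i.val = 0 ∧ e = ⟨opTerm i ![0, 1, 2], Term.var 0⟩) ∨
    (∃ i : Fin n, i.val + 1 = n ∧ e = ⟨opTerm i ![0, 1, 2], Term.var 2⟩) ∨
    (∃ i : Fin n, e = ⟨opTerm i ![0, 1, 0], Term.var 0⟩) ∨
    (∃ i j : Fin n, j.val = i.val + 1 ∧ Even i.val ∧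
      e = ⟨opTerm i ![0, 0, 2], opTerm j ![0, 0, 2]⟩) ∨
    (∃ i j : Fin n, j.val = i.val + 1 ∧ Odd i.val ∧
      e = ⟨opTerm i ![0, 2, 2], opTerm j ![0, 2, 2]⟩)}

/-- The equations of `n` Hagemann-Mitschke operations, here numbered `p₀, …, pₙ₋₁`:
`p₀(x, z, z) = x`, `pᵢ(x, x, z) = pᵢ₊₁(x, z, z)`, `pₙ₋₁(x, x, z) = z`. -/
def hagemannMitschkeEquations (n : ℕ) : Set (opLanguage (Fin n) 3).Equation :=
  {e | (∃ i : Fin n, i.val = 0 ∧ e = ⟨opTerm i ![0, 2, 2], Term.var 0⟩) ∨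
    (∃ i : Fin n, i.val + 1 = n ∧ e = ⟨opTerm i ![0, 0, 2], Term.var 2⟩) ∨
    (∃ i j : Fin n, j.val = i.val + 1 ∧
      e = ⟨opTerm i ![0, 0, 2], opTerm j ![0, 2, 2]⟩)}

end FirstOrder.Language

/-! The finite algebras, with the empty structures adjoined, form a Fraïssé class; only amalgamation
needs equilinearity. Glue `N` and `P` over `M` as sets into `Q`, and keep the given operations on
tuples from `N` or from `P`. On mixed tuples, a nontrivial algebra `B` satisfying the axioms, namely
`N` or `P`, serves as an oracle: f(v) := c if f(σv) = σ(c) for all maps σ : Q → B, and a fixed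
default if there is no such c. In an axiom f(x) = g(y) the two argument tuples have the same
entries, so both lie in `N`, or both in `P`, or both are mixed, and then the oracle treats them
alike (`exists_structure_extending`).

The limit is the union of a chain in which every one-sided extension problem is eventually solved
(`IsFraisse.exists_isFraisseLimit_of_finite`). -/

namespace FirstOrder.Language

open Structure

/-! ### Fraïssé limits for classes of finite structures -/

section Fraisse

variable {L : Language.{u, v}} {K : Set (Bundled.{w} L.Structure)}

/-- Finitely many one-sided amalgamation problems over substructures of `C` can be solved
simultaneously. -/
theorem IsFraisse.exists_embedding_extending [hK : IsFraisse K] {ι : Type*} [Finite ι]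
    {C : Bundled.{w} L.Structure} (hC : C ∈ K) (S : ι → L.Substructure C) (hS : ∀ i, (S i).FG)
    (B : ι → Bundled.{w} L.Structure) (hB : ∀ i, B i ∈ K) (g : ∀ i, S i ↪[L] B i) :
    ∃ D ∈ K, ∃ e : C ↪[L] D, ∀ i, ∃ h : B i ↪[L] D, ∀ x : S i, h (g i x) = e x := by
  classical
  have := Fintype.ofFinite ι
  suffices H : ∀ s : Finset ι, ∃ D ∈ K, ∃ e : C ↪[L] D,
      ∀ i ∈ s, ∃ h : B i ↪[L] D, ∀ x : S i, h (g i x) = e x by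
    obtain ⟨D, hD, e, h⟩ := H Finset.univ
    exact ⟨D, hD, e, fun i => h i (Finset.mem_univ i)⟩
  intro s
  induction s using Finset.induction_on with
  | empty => exact ⟨C, hC, Embedding.refl L C, by simp⟩
  | insert i s _ ih =>
    obtain ⟨D, hD, e, h⟩ := ih
    have hSi : (Bundled.mk (S i) : Bundled.{w} L.Structure) ∈ K := hK.hereditary C hC
      (age.fg_substructure (hS i))
    obtain ⟨Q, a, b, hQ, hab⟩ := hK.amalgamation (Bundled.mk (S i)) D (B i)
      (e.comp (S i).subtype) (g i) hSi hD (hB i)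
    refine ⟨Q, hQ, a.comp e, fun j hj => ?_⟩
    rcases Finset.mem_insert.1 hj with rfl | hj
    · exact ⟨b, fun x => (DFunLike.congr_fun hab x).symm⟩
    · obtain ⟨k, hk⟩ := h j hj
      exact ⟨a.comp k, fun x => congrArg a (hk x)⟩

theorem IsFraisse.exists_representatives [hK : IsFraisse K] :
    ∃ B : ℕ → Bundled.{w} L.Structure,
      (∀ n, B n ∈ K) ∧ ∀ N ∈ K, ∃ n, Nonempty (N ≃[L] B n) := by
  obtain ⟨F, hF⟩ := hK.is_essentially_countable.exists_eq_range (hK.is_nonempty.image _)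
  have h1 : ∀ n, ∃ N ∈ K, Quotient.mk' N = F n := fun n => by
    have : F n ∈ Quotient.mk' '' K := hF ▸ Set.mem_range_self n
    exact this
  choose B hB hBF using h1
  refine ⟨B, hB, fun N hN => ?_⟩
  have : Quotient.mk' N ∈ Set.range F := hF ▸ Set.mem_image_of_mem _ hN
  obtain ⟨n, hn⟩ := this
  exact ⟨n, Quotient.exact (hn.symm.trans (hBF n).symm)⟩

/-- Finitely many generators of the image already occur at a common stage. -/
theorem DirectLimit.exists_factor_of_fg {ι : Type*} [Preorder ι] [IsDirectedOrder ι] [Nonempty ι]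
    {G : ι → Type w} [∀ i, L.Structure (G i)] (f : ∀ i j, i ≤ j → G i ↪[L] G j)
    [DirectedSystem G fun i j h => f i j h] {A : Type*} [L.Structure A] (hA : Structure.FG L A)
    (a : A ↪[L] DirectLimit G f) :
    ∃ i, ∃ b : A ↪[L] G i, ∀ x, DirectLimit.of L ι G f i (b x) = a x := by
  obtain ⟨i, T, hT⟩ := DirectLimit.exists_fg_substructure_in_Sigma _ (hA.range a.toHom)
  have hle : a.toHom.range ≤ (DirectLimit.of L ι G f i).toHom.range := by
    rw [← hT, Hom.range_eq_map]
    exact Substructure.monotone_map le_top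
  refine ⟨i, (DirectLimit.of L ι G f i).equivRange.symm.toEmbedding.comp
    ((Substructure.inclusion hle).comp a.equivRange.toEmbedding), fun x => ?_⟩
  have := congrArg Subtype.val ((DirectLimit.of L ι G f i).equivRange.apply_symm_apply
    (Substructure.inclusion hle (a.equivRange x)))
  rw [Embedding.equivRange_apply] at this
  exact this

/-- A structure into which the members of `K` embed over any embedded member of `K`, with age `K`,
is ultrahomogeneous. -/
theorem isUltrahomogeneous_of_extends {M : Type w} [L.Structure M] [Countable M]
    (H : ∀ (A B : Bundled.{w} L.Structure) (a : A ↪[L] M) (b : A ↪[L] B), A ∈ L.age M →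
      B ∈ L.age M → ∃ h : B ↪[L] M, ∀ x, h (b x) = a x) : L.IsUltrahomogeneous M := by
  -- By back-and-forth, it suffices to add one point to the domain of a finitely generated partial
  -- embedding.
  rw [isUltrahomogeneous_iff_IsExtensionPair cg_of_countable,
    isExtensionPair_iff_exists_embedding_closure_singleton_sup]
  intro S hS f m
  obtain ⟨h, hh⟩ := H (Bundled.of S)
    (Bundled.of (Substructure.closure L {m} ⊔ S : L.Substructure M)) f
    (Substructure.inclusion le_sup_right) (age.fg_substructure hS)
    (age.fg_substructure ((Substructure.fg_closure_singleton m).sup hS))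
  exact ⟨h, Embedding.ext fun x => (hh x).symm⟩

/-- A Fraïssé class of finite structures has a Fraïssé limit. -/
theorem IsFraisse.exists_isFraisseLimit_of_finite [Countable (Σ n, L.Functions n)]
    [hK : IsFraisse K] (hfin : ∀ A ∈ K, Finite A) :
    ∃ (M : Type w) (_ : L.Structure M) (_ : Countable M), L.IsFraisseLimit K M := by
  obtain ⟨B, hB, hrep⟩ := hK.exists_representatives
  -- The bound `k ≤ n` leaves finitely many problems at each stage, yet each target `B k` is treated
  -- at all stages from `k` on.
  have step : ∀ (C : K) (n : ℕ), ∃ D : K, ∃ e : C.1 ↪[L] D.1, Nonempty (B n ↪[L] D.1) ∧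
      ∀ k ≤ n, ∀ (S : L.Substructure C.1) (g : S ↪[L] B k),
        ∃ h : B k ↪[L] D.1, ∀ x : S, h (g x) = e x := by
    rintro ⟨C, hC⟩ n
    have := hfin C hC
    have hfinB := fun k => hfin (B k) (hB k)
    have : Finite (L.Substructure C) := Finite.of_injective _ SetLike.coe_injective
    have (S : L.Substructure C) (k : ℕ) : Finite (S ↪[L] B k) := DFunLike.finite _
    obtain ⟨D, hD, e, he⟩ := hK.exists_embedding_extending
      (ι := Σ (k : Fin (n + 1)) (S : L.Substructure C), S ↪[L] B k) hC (fun i => i.2.1)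
      (fun i => Substructure.FG.of_finite) (fun i => B i.1) (fun i => hB _) (fun i => i.2.2)
    obtain ⟨Q, hQ, ⟨a⟩, b⟩ := hK.jointEmbedding D hD (B n) (hB n)
    refine ⟨⟨Q, hQ⟩, a.comp e, b, fun k hk S g => ?_⟩
    obtain ⟨h, hh⟩ := he ⟨⟨k, Nat.lt_succ_of_le hk⟩, S, g⟩
    exact ⟨a.comp h, fun x => congrArg a (hh x)⟩
  choose next emb hJ hE using step
  obtain ⟨C₀, hC₀⟩ := hK.is_nonempty
  let G : ℕ → K := fun n => Nat.rec ⟨C₀, hC₀⟩ (fun n C => next C n) n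
  let e : ∀ n, (G n).1 ↪[L] (G (n + 1)).1 := fun n => emb (G n) n
  let f : ∀ i j, i ≤ j → (G i).1 ↪[L] (G j).1 := DirectedSystem.natLERec e
  have hf : ∀ n x, f n (n + 1) n.le_succ x = e n x := fun n x => by
    simp only [f, DirectedSystem.coe_natLERec]
    exact Nat.leRecOn_succ' _
  let M := DirectLimit (fun n => (G n).1) f
  let ofG : ∀ n, (G n).1 ↪[L] M := DirectLimit.of L ℕ (fun n => (G n).1) f
  have hM : Countable M := Structure.cg_iff_countable.1
    (DirectLimit.cg f fun n => (hK.FG _ (G n).2).cg)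
  have hage : L.age M = K := by
    refine (age_directLimit (fun n => (G n).1) f).trans (subset_antisymm
      (Set.iUnion_subset fun n N hN => hK.hereditary _ (G n).2 hN) fun N hN => ?_)
    obtain ⟨n, ⟨i⟩⟩ := hrep N hN
    obtain ⟨j⟩ := hJ (G n) n
    exact Set.mem_iUnion_of_mem (n + 1) ⟨hK.FG N hN, ⟨j.comp i.toEmbedding⟩⟩
  refine ⟨M, inferInstance, hM, isUltrahomogeneous_of_extends fun A N a b hA hN => ?_, hage⟩
  obtain ⟨i, a', ha'⟩ := DirectLimit.exists_factor_of_fg f hA.1 a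
  obtain ⟨k, ⟨r⟩⟩ := hrep N (hage ▸ hN)
  -- A stage that contains the image of `A` and is late enough to treat the target `B k`.
  let j := max i k
  let c : A ↪[L] (G j).1 := (f i j (le_max_left i k)).comp a'
  have hc : ∀ x, ofG j (c x) = a x := fun x => by
    rw [← ha' x]
    exact DirectLimit.of_f
  obtain ⟨h, hh⟩ := hE (G j) j k (le_max_right i k) c.toHom.range
    (r.toEmbedding.comp (b.comp c.equivRange.symm.toEmbedding))
  refine ⟨(ofG (j + 1)).comp (h.comp r.toEmbedding), fun x => ?_⟩
  have h1 : h (r (b x)) = e j (c x) := by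
    have := hh (c.equivRange x)
    simpa using this
  calc ofG (j + 1) (h (r (b x))) = ofG (j + 1) (f j (j + 1) j.le_succ (c x)) := by rw [h1, hf]
    _ = ofG j (c x) := DirectLimit.of_f
    _ = a x := hc x

end Fraisse

/-! ### Counting finite structures -/

section Countability

/-- In a finite language, there are countably many finite structures up to isomorphism. -/
theorem countable_quotient_finite (L : Language.{u, v}) [Finite L.Symbols] :
    (Quotient.mk' '' {A : Bundled.{w} L.Structure | Finite A}).Countable := by
  have : Finite (Σ n, L.Functions n) := Finite.of_injective (β := L.Symbols)
    Sum.inl Sum.inl_injective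
  have : Finite (Σ n, L.Relations n) := Finite.of_injective (β := L.Symbols)
    Sum.inr Sum.inr_injective
  -- A structure on this set is given by finitely many finite tables.
  have (n : ℕ) : Finite (L.Structure (ULift.{w} (Fin n))) := by
    let X := ULift.{w} (Fin n)
    let φ : L.Structure X → (∀ s : Σ n, L.Functions n, (Fin s.1 → X) → X) ×
        (∀ s : Σ n, L.Relations n, (Fin s.1 → X) → Prop) :=
      fun S => ⟨fun s => S.funMap s.2, fun s => S.RelMap s.2⟩
    refine Finite.of_injective φ fun S T h => Structure.ext ?_ ?_
    · funext n f
      exact congrFun (congrArg Prod.fst h) ⟨n, f⟩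
    · funext n r
      exact congrFun (congrArg Prod.snd h) ⟨n, r⟩
  refine (Set.countable_range fun S : Σ n, L.Structure (ULift.{w} (Fin n)) =>
    (Quotient.mk' (⟨_, S.2⟩ : Bundled.{w} L.Structure))).mono ?_
  rintro _ ⟨A, hA, rfl⟩
  have : Finite A := hA
  obtain ⟨n, ⟨i⟩⟩ := Finite.exists_equiv_fin A
  let k : A ≃ ULift.{w} (Fin n) := i.trans Equiv.ulift.symm
  let S : L.Structure (ULift.{w} (Fin n)) := k.inducedStructure
  exact ⟨⟨n, S⟩, Quotient.sound ⟨k.inducedStructureEquiv.symm⟩⟩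

end Countability

/-! ### Validity of equilinear equations -/

section Equations

variable {L : Language.{u, v}}

theorem Equation.ValidIn.of_embedding {e : L.Equation} {A B : Type*} [L.Structure A]
    [L.Structure B] (h : e.ValidIn B) (i : A ↪[L] B) : e.ValidIn A := fun ρ => i.injective <| by
  simpa only [HomClass.realize_term] using h (i ∘ ρ)

theorem Equation.validIn_of_subsingleton (e : L.Equation) (A : Type*) [L.Structure A]
    [Subsingleton A] : e.ValidIn A := fun _ => Subsingleton.elim _ _

theorem Equation.validIn_op_var {n : ℕ} {f : L.Functions n} {x : Fin n → ℕ} {y : ℕ}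
    {A : Type*} [L.Structure A] :
    (⟨Term.func f fun i => Term.var (x i), Term.var y⟩ : L.Equation).ValidIn A ↔
      ∀ ρ : ℕ → A, funMap f (ρ ∘ x) = ρ y := Iff.rfl

theorem Equation.validIn_var_op {n : ℕ} {f : L.Functions n} {x : Fin n → ℕ} {y : ℕ}
    {A : Type*} [L.Structure A] :
    (⟨Term.var y, Term.func f fun i => Term.var (x i)⟩ : L.Equation).ValidIn A ↔
      ∀ ρ : ℕ → A, funMap f (ρ ∘ x) = ρ y := forall_congr' fun _ => eq_comm

theorem Equation.validIn_op_op {n m : ℕ} {f : L.Functions n} {g : L.Functions m}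
    {x : Fin n → ℕ} {y : Fin m → ℕ} {A : Type*} [L.Structure A] :
    (⟨Term.func f fun i => Term.var (x i), Term.func g fun j => Term.var (y j)⟩ :
      L.Equation).ValidIn A ↔ ∀ ρ : ℕ → A, funMap f (ρ ∘ x) = funMap g (ρ ∘ y) := Iff.rfl

/-- Otherwise changing the value of `y` alone would change the right side but not the left. -/
theorem mem_range_of_forall_funMap_eq {n : ℕ} {f : L.Functions n} {x : Fin n → ℕ} {y : ℕ}
    {B : Type*} [L.Structure B] [Nontrivial B] (h : ∀ ρ : ℕ → B, funMap f (ρ ∘ x) = ρ y) :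
    y ∈ Set.range x := by
  by_contra hy
  obtain ⟨b, c, hbc⟩ := exists_pair_ne B
  have h1 := h fun _ => b
  have h2 := h (Function.update (fun _ => b) y c)
  rw [Function.update_self] at h2
  refine hbc (h1.symm.trans (Eq.trans ?_ h2))
  congr 1
  funext k
  have : x k ≠ y := fun hk => hy ⟨k, hk⟩
  simp [Function.update_of_ne this]

end Equations

/-! ### Amalgamation of finite algebras -/

section Amalgamation

variable {L : Language.{u, v}}

/-- The pushout of two injections of types. -/
theorem exists_type_amalgam {M N P : Type w} [Finite N] [Finite P] {a : M → N} {b : M → P}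
    (ha : Function.Injective a) (hb : Function.Injective b) :
    ∃ (Q : Type w) (_ : Finite Q) (i : N → Q) (j : P → Q), Function.Injective i ∧
      Function.Injective j ∧ (∀ m, i (a m) = j (b m)) ∧
        ∀ n p, i n = j p → ∃ m, a m = n ∧ b m = p := by
  classical
  let j : P → N ⊕ {p : P // p ∉ Set.range b} := fun p =>
    if h : p ∈ Set.range b then Sum.inl (a h.choose) else Sum.inr ⟨p, h⟩
  have hj (m : M) : j (b m) = Sum.inl (a m) := by
    have h : b m ∈ Set.range b := ⟨m, rfl⟩
    simp only [j, dif_pos h, hb h.choose_spec]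
  have hj' (p : P) (h : p ∉ Set.range b) : j p = Sum.inr ⟨p, h⟩ := dif_neg h
  refine ⟨N ⊕ {p : P // p ∉ Set.range b}, inferInstance, Sum.inl, j, Sum.inl_injective,
    fun p q hpq => ?_, fun m => (hj m).symm, fun n p h => ?_⟩
  · by_cases hp : p ∈ Set.range b <;> by_cases hq : q ∈ Set.range b
    · obtain ⟨m, rfl⟩ := hp
      obtain ⟨m', rfl⟩ := hq
      rw [hj, hj] at hpq
      rw [ha (Sum.inl_injective hpq)]
    · obtain ⟨m, rfl⟩ := hp
      rw [hj, hj' q hq] at hpq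
      simp at hpq
    · obtain ⟨m, rfl⟩ := hq
      rw [hj, hj' p hp] at hpq
      simp at hpq
    · rw [hj' p hp, hj' q hq] at hpq
      simpa using hpq
  · by_cases hp : p ∈ Set.range b
    · obtain ⟨m, rfl⟩ := hp
      rw [hj] at h
      exact ⟨m, (Sum.inl_injective h).symm, rfl⟩
    · rw [hj' p hp] at h
      simp at h

/-- Extend the operations of two algebras `N` and `P`, embedded in a set `Q` with compatible
operations, to `Q`: outside of `N` and `P`, a value is chosen among the arguments
whenever the equations that hold in `B` force it. -/
theorem exists_structure_extending (B : Type*) [L.IsAlgebraic] [L.Structure B] [Nontrivial B]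
    {N P : Type w} {Q : Type*} [L.Structure N] [L.Structure P] [Nonempty N] [Nonempty P]
    {i : N → Q} {j : P → Q}
    (hi : Function.Injective i) (hj : Function.Injective j)
    (hij : ∀ {n} (f : L.Functions n) (v : Fin n → N) (w : Fin n → P),
      i ∘ v = j ∘ w → i (funMap f v) = j (funMap f w)) :
    ∃ _ : L.Structure Q,
      (∀ {n} (f : L.Functions n) (v : Fin n → N), funMap f (i ∘ v) = i (funMap f v)) ∧
      (∀ {n} (f : L.Functions n) (v : Fin n → P), funMap f (j ∘ v) = j (funMap f v)) ∧
      ∀ e : L.Equation, e.IsEquilinear → e.ValidIn B → e.ValidIn N → e.ValidIn P →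
        e.ValidIn Q := by
  classical
  let F {n : ℕ} (f : L.Functions n) (v : Fin n → Q) : Q :=
    if h : ∃ w : Fin n → N, i ∘ w = v then i (funMap f h.choose)
    else if h : ∃ w : Fin n → P, j ∘ w = v then j (funMap f h.choose)
    -- Such a `c` is unique, since maps into the nontrivial `B` separate points. The default in the
    -- last branch depends on neither `f` nor `v`.
    else if h : ∃ c, ∀ σ : Q → B, funMap f (σ ∘ v) = σ c then h.choose
    else i (Classical.arbitrary N)
  have Fi {n : ℕ} (f : L.Functions n) (v : Fin n → N) : F f (i ∘ v) = i (funMap f v) := by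
    have h : ∃ w : Fin n → N, i ∘ w = i ∘ v := ⟨v, rfl⟩
    simp only [F, dif_pos h]
    rw [hi.comp_left h.choose_spec]
  have Fj {n : ℕ} (f : L.Functions n) (v : Fin n → P) : F f (j ∘ v) = j (funMap f v) := by
    by_cases h : ∃ w : Fin n → N, i ∘ w = j ∘ v
    · obtain ⟨w, hw⟩ := h
      rw [← hw, Fi, hij f w v hw]
    · have h' : ∃ w : Fin n → P, j ∘ w = j ∘ v := ⟨v, rfl⟩
      simp only [F, dif_neg h, dif_pos h']
      rw [hj.comp_left h'.choose_spec]
  have Fc {n : ℕ} (f : L.Functions n) (v : Fin n → Q) (h1 : ¬ ∃ w, i ∘ w = v)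
      (h2 : ¬ ∃ w, j ∘ w = v) (c : Q) (hc : ∀ σ : Q → B, funMap f (σ ∘ v) = σ c) :
      F f v = c := by
    have h : ∃ c, ∀ σ : Q → B, funMap f (σ ∘ v) = σ c := ⟨c, hc⟩
    simp only [F, dif_neg h1, dif_neg h2, dif_pos h]
    by_contra hne
    obtain ⟨b, b', hb⟩ := exists_pair_ne B
    refine hb ?_
    have := (h.choose_spec (Function.update (fun _ => b') h.choose b)).symm.trans (hc _)
    rwa [Function.update_self, Function.update_of_ne (Ne.symm hne)] at this
  -- The oracle conditions for `f`, `v` and for `g`, `w` become the same proposition, so the chosen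
  -- or default values agree.
  have Ffg {n m : ℕ} (f : L.Functions n) (g : L.Functions m) (v : Fin n → Q) (w : Fin m → Q)
      (h1 : ¬ ∃ u, i ∘ u = v) (h2 : ¬ ∃ u, j ∘ u = v) (h3 : ¬ ∃ u, i ∘ u = w)
      (h4 : ¬ ∃ u, j ∘ u = w) (h : ∀ σ : Q → B, funMap f (σ ∘ v) = funMap g (σ ∘ w)) :
      F f v = F g w := by
    simp only [F, dif_neg h1, dif_neg h2, dif_neg h3, dif_neg h4, h]
  -- Pulls the assignment `ρ` back along `k`, correctly on the variables that occur, so that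
  -- validity in `N` or `P` applies.
  have factor {A : Type w} [Nonempty A] (k : A → Q) {n m : ℕ} {x : Fin n → ℕ} {y : Fin m → ℕ}
      (hxy : Set.range y ⊆ Set.range x) (ρ : ℕ → Q) (h : ∃ w, k ∘ w = ρ ∘ x) :
      k ∘ (Function.invFun k ∘ ρ) ∘ y = ρ ∘ y := by
    obtain ⟨w, hw⟩ := h
    funext l
    obtain ⟨l', hl'⟩ := hxy ⟨l, rfl⟩
    exact Function.invFun_eq ⟨w l', by rw [← hl']; exact congrFun hw l'⟩
  let _ : L.Structure Q := { funMap := F, RelMap := fun r => isEmptyElim r }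
  have op_var {n : ℕ} (f : L.Functions n) (x : Fin n → ℕ) (y : ℕ)
      (hB : ∀ ρ : ℕ → B, funMap f (ρ ∘ x) = ρ y) (hN : ∀ ρ : ℕ → N, funMap f (ρ ∘ x) = ρ y)
      (hP : ∀ ρ : ℕ → P, funMap f (ρ ∘ x) = ρ y) (ρ : ℕ → Q) : F f (ρ ∘ x) = ρ y := by
    obtain ⟨l, rfl⟩ := mem_range_of_forall_funMap_eq hB
    by_cases h1 : ∃ w, i ∘ w = ρ ∘ x
    · have := factor i subset_rfl ρ h1
      rw [← this, Fi, hN]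
      exact congrFun this l
    by_cases h2 : ∃ w, j ∘ w = ρ ∘ x
    · have := factor j subset_rfl ρ h2
      rw [← this, Fj, hP]
      exact congrFun this l
    exact Fc f _ h1 h2 _ fun σ => hB (σ ∘ ρ)
  refine ⟨_, Fi, Fj, fun e he hB hN hP => ?_⟩
  cases he with
  | op_var f x y => exact op_var f x y hB hN hP
  | var_op f x y =>
    rw [Equation.validIn_var_op] at *
    exact op_var f x y hB hN hP
  | op_op f g x y hxy =>
    rw [Equation.validIn_op_op] at *
    intro ρ
    change F f (ρ ∘ x) = F g (ρ ∘ y)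
    by_cases h1 : ∃ w, i ∘ w = ρ ∘ x
    · rw [← factor i subset_rfl ρ h1, ← factor i hxy.ge ρ h1, Fi, Fi, hN]
    by_cases h2 : ∃ w, j ∘ w = ρ ∘ x
    · rw [← factor j subset_rfl ρ h2, ← factor j hxy.ge ρ h2, Fj, Fj, hP]
    exact Ffg f g _ _ h1 h2 (fun h => h1 ⟨_, factor i hxy.le ρ h⟩)
      (fun h => h2 ⟨_, factor j hxy.le ρ h⟩) fun σ => hB (σ ∘ ρ)

/-- The embedding of an empty structure. -/
def Embedding.ofIsEmpty [L.IsAlgebraic] (A B : Type*) [L.Structure A] [L.Structure B] [IsEmpty A] :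
    A ↪[L] B where
  toFun := isEmptyElim
  inj' := fun a => isEmptyElim a
  map_fun' := fun f x => isEmptyElim (funMap f x)
  map_rel' := fun r => isEmptyElim r

theorem amalgamation_finiteAlgebras [L.IsAlgebraic] {E : Set L.Equation}
    (hE : ∀ e ∈ E, e.IsEquilinear) :
    Amalgamation (finiteAlgebras.{u, v, w} E ∪ {A : Bundled.{w} L.Structure | IsEmpty A}) := by
  rintro M N P a b hM (⟨⟨hN, hNE⟩, hNf⟩ | hN) hP'
  swap
  · have : IsEmpty N := hN
    have : IsEmpty M := a.toFun.isEmpty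
    exact ⟨P, Embedding.ofIsEmpty N P, Embedding.refl L P, hP', Embedding.ext isEmptyElim⟩
  obtain ⟨⟨hP, hPE⟩, hPf⟩ | hP := hP'
  swap
  · have : IsEmpty P := hP
    have : IsEmpty M := b.toFun.isEmpty
    exact ⟨N, Embedding.refl L N, Embedding.ofIsEmpty P N, Or.inl ⟨⟨hN, hNE⟩, hNf⟩,
      Embedding.ext isEmptyElim⟩
  -- Two one-element algebras are identified, as the variety may have no nontrivial member to serve
  -- as oracle.
  by_cases htriv : Subsingleton N ∧ Subsingleton P
  · obtain ⟨_, _⟩ := htriv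
    let k : P →[L] N :=
      { toFun := fun _ => hN.some
        map_fun' := fun _ _ => Subsingleton.elim _ _
        map_rel' := fun r => isEmptyElim r }
    exact ⟨N, Embedding.refl L N,
      Embedding.ofInjective (f := k) (Function.injective_of_subsingleton _),
      Or.inl ⟨⟨hN, hNE⟩, hNf⟩, Embedding.ext fun _ => Subsingleton.elim _ _⟩
  obtain ⟨B, hB, hBE⟩ : ∃ B : Bundled.{w} L.Structure, Nontrivial B ∧ ∀ e ∈ E, e.ValidIn B := by
    simp only [not_and_or, not_subsingleton_iff_nontrivial] at htriv
    exact htriv.elim (fun h => ⟨N, h, hNE⟩) (fun h => ⟨P, h, hPE⟩)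
  obtain ⟨Q, hQ, i, j, hi, hj, hij, hover⟩ := exists_type_amalgam a.injective b.injective
  obtain ⟨_, hfi, hfj, hval⟩ := exists_structure_extending (L := L) B hi hj
    (fun {n} f v w hvw => by
      choose u hu using fun k => hover (v k) (w k) (congrFun hvw k)
      obtain rfl : a ∘ u = v := funext fun k => (hu k).1
      obtain rfl : b ∘ u = w := funext fun k => (hu k).2
      rw [← Embedding.map_fun, ← Embedding.map_fun, hij])
  let i' : N →[L] Q := ⟨i, fun f v => (hfi f v).symm, fun r => isEmptyElim r⟩
  let j' : P →[L] Q := ⟨j, fun f v => (hfj f v).symm, fun r => isEmptyElim r⟩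
  exact ⟨Bundled.of Q, Embedding.ofInjective (f := i') hi, Embedding.ofInjective (f := j') hj,
    Or.inl ⟨⟨hN.map i, fun e he => hval e (hE e he) (hBE e he) (hNE e he) (hPE e he)⟩, hQ⟩,
    Embedding.ext hij⟩

end Amalgamation

/-! ### The Fraïssé class of finite algebras -/

theorem hasFraisseLimit_finiteAlgebras (L : Language.{u, v}) [L.IsAlgebraic] [Finite L.Symbols]
    [IsEmpty L.Constants] [Countable (Σ n, L.Functions n)] {E : Set L.Equation}
    (hE : ∀ e ∈ E, e.IsEquilinear) : HasFraisseLimit (finiteAlgebras.{u, v, w} E) := by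
  have hfin : ∀ A ∈ finiteAlgebras.{u, v, w} E ∪ {A | IsEmpty A}, Finite A := by
    rintro A (hA | hA)
    · exact hA.2
    · have : IsEmpty A := hA
      infer_instance
  -- Without constants there is an empty structure; amalgamation over it gives joint embedding.
  obtain ⟨Z, _⟩ : ∃ Z : Bundled.{w} L.Structure, IsEmpty Z :=
    ⟨⟨PEmpty, { funMap := fun {n} f x => match n, f, x with
                  | 0, f, _ => isEmptyElim (α := L.Constants) f
                  | _ + 1, _, x => x 0
                RelMap := fun r => isEmptyElim r }⟩, inferInstanceAs (IsEmpty PEmpty)⟩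
  have hZ : Z ∈ finiteAlgebras.{u, v, w} E ∪ {A | IsEmpty A} := Or.inr ‹_›
  -- The one-element algebra satisfies every equation; it embeds into the limit, which is therefore
  -- nonempty.
  obtain ⟨T, _, ⟨t⟩⟩ : ∃ T : Bundled.{w} L.Structure, Subsingleton T ∧ Nonempty T :=
    ⟨⟨PUnit, { funMap := fun _ _ => PUnit.unit, RelMap := fun r => isEmptyElim r }⟩,
      inferInstanceAs (Subsingleton PUnit), ⟨PUnit.unit⟩⟩
  have hT : T ∈ finiteAlgebras.{u, v, w} E ∪ {A | IsEmpty A} :=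
    Or.inl ⟨⟨⟨t⟩, fun e _ => e.validIn_of_subsingleton T⟩, inferInstanceAs (Finite T)⟩
  have : IsFraisse (finiteAlgebras.{u, v, w} E ∪ {A | IsEmpty A}) :=
    { is_nonempty := ⟨Z, hZ⟩
      FG := fun A hA => by
        have := hfin A hA
        exact Structure.FG.of_finite
      is_essentially_countable := (countable_quotient_finite L).mono (Set.image_mono hfin)
      hereditary := by
        rintro A hA B ⟨-, ⟨i⟩⟩
        have := hfin A hA
        obtain hB | hB := isEmpty_or_nonempty B
        · exact Or.inr hB
        obtain hA | hA := hA
        · exact Or.inl ⟨⟨hB, fun e he => (hA.1.2 e he).of_embedding i⟩,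
            Finite.of_injective i i.injective⟩
        · exact (hA.false (i hB.some)).elim
      jointEmbedding := fun A hA B hB => by
        obtain ⟨Q, i, j, hQ, -⟩ := amalgamation_finiteAlgebras hE Z A B
          (Embedding.ofIsEmpty Z A) (Embedding.ofIsEmpty Z B) hZ hA hB
        exact ⟨Q, hQ, ⟨i⟩, ⟨j⟩⟩
      amalgamation := amalgamation_finiteAlgebras hE }
  obtain ⟨M, _, hM, hlim⟩ := IsFraisse.exists_isFraisseLimit_of_finite hfin
  have hTM : T ∈ L.age M := hlim.age ▸ hT
  exact ⟨M, _, hM, ⟨hTM.2.some t⟩, hlim⟩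

/-! ### The languages of the listed varieties -/

section OpLanguage

variable {ι : Type} {k : ℕ}

instance : (opLanguage ι k).IsAlgebraic := fun _ => inferInstanceAs (IsEmpty Empty)

instance finite_symbols_opLanguage [Finite ι] : Finite (opLanguage ι k).Symbols := by
  have : Finite (Σ n, (opLanguage ι k).Functions n) := by
    refine Finite.of_surjective
      (fun i : ι => (⟨k, OpSymbol.op i⟩ : Σ n, (opLanguage ι k).Functions n)) ?_
    rintro ⟨_, ⟨i⟩⟩
    exact ⟨i, rfl⟩
  have : IsEmpty (Σ n, (opLanguage ι k).Relations n) := ⟨fun r => Empty.elim r.2⟩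
  exact inferInstanceAs (Finite (_ ⊕ Σ n, (opLanguage ι k).Relations n))

theorem isEmpty_constants_opLanguage (hk : k ≠ 0) : IsEmpty (opLanguage ι k).Constants := by
  refine ⟨fun c => ?_⟩
  have h : ∀ n, OpSymbol ι k n → n = k := by rintro _ ⟨_⟩; rfl
  exact hk (h 0 c).symm

theorem hasFraisseLimit_opLanguage [Finite ι] (hk : k ≠ 0) {E : Set (opLanguage ι k).Equation}
    (hE : ∀ e ∈ E, e.IsEquilinear) : HasFraisseLimit (finiteAlgebras.{0, 0, w} E) :=
  have := isEmpty_constants_opLanguage (ι := ι) hk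
  hasFraisseLimit_finiteAlgebras _ hE

end OpLanguage

end FirstOrder.Language

theorem corollary3p4 :
    (∀ (L : FirstOrder.Language.{u, v}) [L.IsAlgebraic] [Finite L.Symbols] [IsEmpty L.Constants]
      (E : Set L.Equation), (∀ e ∈ E, e.IsEquilinear) →
        Language.HasFraisseLimit (Language.finiteAlgebras.{u, v, w} E)) ∧
    Language.HasFraisseLimit (Language.finiteAlgebras.{0, 0, w} Language.maltsevEquations) ∧
    Language.HasFraisseLimit (Language.finiteAlgebras.{0, 0, w} Language.pixleyEquations) ∧
    (∀ n : ℕ, 1 ≤ n → Language.HasFraisseLimit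
      (Language.finiteAlgebras.{0, 0, w} (Language.nearUnanimityEquations n))) ∧
    (∀ n : ℕ, Language.HasFraisseLimit
      (Language.finiteAlgebras.{0, 0, w} (Language.dayEquations n))) ∧
    (∀ n : ℕ, Language.HasFraisseLimit
      (Language.finiteAlgebras.{0, 0, w} (Language.jonssonEquations n))) ∧
    (∀ n : ℕ, Language.HasFraisseLimit
      (Language.finiteAlgebras.{0, 0, w} (Language.hagemannMitschkeEquations n))) := by
  refine ⟨fun L _ _ _ E hE => Language.hasFraisseLimit_finiteAlgebras L hE,
    Language.hasFraisseLimit_opLanguage three_ne_zero ?_,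
    Language.hasFraisseLimit_opLanguage three_ne_zero ?_,
    fun n hn => Language.hasFraisseLimit_opLanguage (Nat.one_le_iff_ne_zero.1 hn) ?_,
    fun n => Language.hasFraisseLimit_opLanguage four_ne_zero ?_,
    fun n => Language.hasFraisseLimit_opLanguage three_ne_zero ?_,
    fun n => Language.hasFraisseLimit_opLanguage three_ne_zero ?_⟩
  · rintro e (rfl | rfl)
    · exact .var_op _ _ _
    · exact .op_var _ _ _
  · rintro e (rfl | rfl | rfl) <;> exact .op_var _ _ _
  · rintro e ⟨j, rfl⟩
    exact .op_var _ _ _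
  · rintro e (⟨i, -, rfl⟩ | ⟨i, -, rfl⟩ | ⟨i, rfl⟩ | ⟨i, j, -, -, rfl⟩ | ⟨i, j, -, -, rfl⟩)
    iterate 3 exact .op_var _ _ _
    all_goals exact .op_op _ _ _ _ rfl
  · rintro e (⟨i, -, rfl⟩ | ⟨i, -, rfl⟩ | ⟨i, rfl⟩ | ⟨i, j, -, -, rfl⟩ | ⟨i, j, -, -, rfl⟩)
    iterate 3 exact .op_var _ _ _
    all_goals exact .op_op _ _ _ _ rfl
  · rintro e (⟨i, -, rfl⟩ | ⟨i, -, rfl⟩ | ⟨i, j, -, rfl⟩)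
    iterate 2 exact .op_var _ _ _
    -- Here the argument tuples differ, but both use exactly the variables 0 and 2.
    refine .op_op _ _ _ _ ?_
    simp [Matrix.range_cons, Matrix.range_empty]
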